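/- **Setting.** There are $n$ users, a library of $m$ files, cache capacity $M\ge 0$ (in files), and a demand distribution $\mathbf q=(q_1,\dots,q_m)$, a probability mass function on the files. Each file consists of $F$ bits and is divided into $B=B(F)$ packets of equal size, where $B\to\infty$ as $F\to\infty$ (for instance with $F/B$ tending to a constant). The caching distribution is $\mathbf p=(p_1,\dots,p_m)$ with $p_f\ge 0$, $p_fM\le 1$ and $\sum_f p_f=1$; $n,m,M,\mathbf q,\mathbf p$ are fixed. *Placement.* Independently over users $u$ and files $f$, user $u$ caches a uniformly random set $\mathsf C_{u,f}$ of $p_fMB$ of the $B$ packets of file $f$ (rounded down if this is not an integer). Independently of the caches $\mathsf C$, users request files $\mathsf f_1,\dots,\mathsf f_n$, i.i.d. with distribution $\mathbf q$. *Conflict graph.* There is one vertex $v$ for every user $u$ and every packet of file $\mathsf f_u$ not cached by $u$; it has the labels $\rho(v)$ = that packet (file and packet index), $\mu(v)=u$, and $\eta(v)$ = the set of all users caching that packet. Vertices $v_1,v_2$ are adjacent iff $\rho(v_1)\ne\rho(v_2)$ and ($\mu(v_1)\notin\eta(v_2)$ or $\mu(v_2)\notin\eta(v_1)$). *Greedy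 Constrained Coloring (GCC).* Both GCC$_1$ and GCC$_2$ repeat the following until all vertices are colored: pick any uncolored vertex $v$, let $I=\{v\}$, go through the other uncolored vertices $v'$ in any order, adding $v'$ to $I$ if it passes a test; then give $I$ a new color. The test of GCC$_1$ is that $v'$ has no edge to the current $I$ and $\{\mu(v')\}\cup\eta(v')=\{\mu(v)\}\cup\eta(v)$; the test of GCC$_2$ is $\rho(v')=\rho(v)$. GCC outputs whichever of the two colorings has fewer colors. *Rates.* $R^{\rm GCC}=\mathbb E[\text{number of colors used by GCC}\mid\mathsf C]/B$ and $R^{\rm CIC}=\mathbb E[\text{chromatic number of the conflict graph}\mid\mathsf C]/B$ (chromatic-number index coding); these are random variables, functions of $\mathsf C$. **Theorem.** For every $\varepsilon>0$, whatever the arbitrary choices made in GCC, $$\lim_{F\to\infty}\mathbb P\big(R^{\rm GCC}\le\min\{\psi(\mathbf q,\mathbf p),\bar m\}+\varepsilon\big)=1,$$ where $$\bar m=\sum_{f=1}^m\big(1-(1-q_f)^n\big),\qquad \psi(\mathbf q,\mathbf p)=\sum_{\ell=1}^n\binom n\ell\sum_{f=1}^m\rho_{f,\ell}\,(p_fM)^{\ell-1}(1-p_fM)^{n-\ell+1},$$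 and $\rho_{f,\ell}=\mathbb P\big(f=\arg\max_{j\in\mathcal D}g_\ell(j)\big)$ with $g_\ell(j)=(p_jM)^{\ell-1}(1-p_jM)^{n-\ell+1}$ and $\mathcal D$ a vector of $\ell$ i.i.d. draws from $\mathbf q$; here $\arg\max$ denotes a single maximizing entry of $\mathcal D$, ties being broken by any fixed rule. The same limit holds with $R^{\rm CIC}$ in place of $R^{\rm GCC}$. -/

import Mathlib

open MeasureTheory ProbabilityTheory Filter Topology

namespace Caching

/-- Finite sets of packet indices carry the discrete sigma-algebra. -/
instance finsetMeasurableSpace (B : ℕ) : MeasurableSpace (Finset (Fin B)) := ⊤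

/-- A cache configuration for `n` users, `m` files and `B` packets per file:
`C u f` is the set of indices of the packets of file `f` cached by user `u`. -/
abbrev CacheConfig (n m B : ℕ) : Type := Fin n → Fin m → Finset (Fin B)

/-- A demand vector: `d u` is the file requested by user `u`. -/
abbrev Demand (n m : ℕ) : Type := Fin n → Fin m

/-! ### Probability model -/

/-- The distribution of one request, with probability mass function `q`. -/
noncomputable def requestLaw {m : ℕ} (q : Fin m → ℝ) : Measure (Fin m) :=
  ∑ f, ENNReal.ofReal (q f) • Measure.dirac f

/-- `ℓ` i.i.d. requests distributed according to `q`. -/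
noncomputable def requestsLaw {m : ℕ} (q : Fin m → ℝ) (ℓ : ℕ) : Measure (Fin ℓ → Fin m) :=
  Measure.pi fun _ => requestLaw q

/-- Random fractional placement: independently over users `u` and files `f`, the set of packets of
`f` cached by `u` is uniform among the sets of `p f * M * B` packets (rounded down to an integer,
in case it is not one). -/
noncomputable def placementLaw {m : ℕ} (n : ℕ) (p : Fin m → ℝ) (M : ℝ) (B : ℕ) :
    Measure (CacheConfig n m B) :=
  Measure.pi fun _ => Measure.pi fun f =>
    uniformOn {S : Finset (Fin B) | S.card = ⌊p f * M * (B : ℝ)⌋₊}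

/-- Joint law of the random cache configuration and of the independent i.i.d. demand vector. -/
noncomputable def jointLaw {m : ℕ} (n : ℕ) (q p : Fin m → ℝ) (M : ℝ) (B : ℕ) :
    Measure (CacheConfig n m B × Demand n m) :=
  (placementLaw n p M B).prod (requestsLaw q n)

/-! ### The conflict graph -/

/-- Vertex labels: packet identity (file, index), user requesting, users caching. -/
@[ext]
structure Label (n m B : ℕ) where
  /-- packet identity -/
  packet : Fin m × Fin B
  /-- user requesting -/
  user : Fin n
  /-- users caching -/
  cachers : Finset (Fin n)

/-- The set of all users that cache packet `x`. -/
def cachersOf {n m B : ℕ} (C : CacheConfig n m B) (x : Fin m × Fin B) : Finset (Fin n) :=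
  Finset.univ.filter fun u => x.2 ∈ C u x.1

open Classical in
/-- The labels that occur: one for each user `u` and each packet of the file requested by `u`
that `u` does not cache. -/
noncomputable def labels {n m B : ℕ} (C : CacheConfig n m B) (d : Demand n m) :
    Finset (Label n m B) :=
  (Finset.univ.filter fun x : Fin n × Fin B => x.2 ∉ C x.1 (d x.1)).image
    fun x => ⟨(d x.1, x.2), x.1, cachersOf C (d x.1, x.2)⟩

/-- Vertices of the conflict graph. -/
abbrev Vertex {n m B : ℕ} (C : CacheConfig n m B) (d : Demand n m) : Type :=
  {v : Label n m B // v ∈ labels C d}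

/-- The conflict graph. -/
def conflictGraph {n m B : ℕ} (C : CacheConfig n m B) (d : Demand n m) :
    SimpleGraph (Vertex C d) where
  Adj v w := v.1.packet ≠ w.1.packet ∧
    (v.1.user ∉ w.1.cachers ∨ w.1.user ∉ v.1.cachers)
  symm := ⟨fun _ _ h => ⟨h.1.symm, h.2.symm⟩⟩
  loopless := ⟨fun _ h => h.1 rfl⟩

/-! ### Greedy constrained coloring -/

open Classical in
/-- Inner loop: starting from `{v}`, go through the vertices of `order` and add `w` to the current
set `I` whenever `accept v I w` holds. -/
noncomputable def growClass {V : Type} (accept : V → Finset V → V → Prop) (v : V)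
    (order : List V) : Finset V :=
  order.foldl (fun I w => if accept v I w then insert w I else I) {v}

open Classical in
/-- `GreedyRun accept S L`: when the set of uncolored vertices is `S`, the outer loop may produce the
list `L` of color classes. Both the root `v` and the order in which the inner loop visits the other
uncolored vertices are arbitrary. -/
inductive GreedyRun {V : Type} (accept : V → Finset V → V → Prop) :
    Finset V → List (Finset V) → Prop
  | done : GreedyRun accept ∅ []
  | step {S : Finset V} {L : List (Finset V)} (v : V) (order : List V) (hv : v ∈ S)
      (hnodup : order.Nodup) (horder : ∀ w, w ∈ order ↔ w ∈ S ∧ w ≠ v)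
      (hrest : GreedyRun accept (S \ growClass accept v order) L) :
      GreedyRun accept S (growClass accept v order :: L)

/-- Test of GCC₁: `w` has no edge to `I` and has the same set of users requesting or caching
as the root `v`. -/
def accept₁ {n m B : ℕ} (C : CacheConfig n m B) (d : Demand n m)
    (v : Vertex C d) (I : Finset (Vertex C d)) (w : Vertex C d) : Prop :=
  (∀ x ∈ I, ¬ (conflictGraph C d).Adj w x) ∧
    insert w.1.user w.1.cachers = insert v.1.user v.1.cachers

/-- Test of GCC₂: `w` asks for the same packet as the root `v`. -/
def accept₂ {n m B : ℕ} (C : CacheConfig n m B) (d : Demand n m)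
    (v : Vertex C d) (_I : Finset (Vertex C d)) (w : Vertex C d) : Prop :=
  w.1.packet = v.1.packet

/-- `L` is the list of color classes of a possible output of GCC: the better of the colorings
produced by a run of GCC₁ and a run of GCC₂ on the whole conflict graph. -/
def IsGCCOutput {n m B : ℕ} (C : CacheConfig n m B) (d : Demand n m)
    (L : List (Finset (Vertex C d))) : Prop :=
  ∃ L₁ L₂, GreedyRun (accept₁ C d) Finset.univ L₁ ∧ GreedyRun (accept₂ C d) Finset.univ L₂ ∧
    (L = L₁ ∨ L = L₂) ∧ L.length = min L₁.length L₂.length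

theorem mem_growClass {V : Type} (accept : V → Finset V → V → Prop) (v : V) (order : List V) :
    v ∈ growClass accept v order := by
  classical
  have key : ∀ (l : List V) (I : Finset V), v ∈ I →
      v ∈ l.foldl (fun I w => if accept v I w then insert w I else I) I := by
    intro l
    induction l with
    | nil => intro I h; simpa using h
    | cons a l ih =>
      intro I h
      rw [List.foldl_cons]
      apply ih
      split_ifs
      · exact Finset.mem_insert_of_mem h
      · exact h
  unfold growClass
  convert key order {v} (Finset.mem_singleton_self v)

theorem exists_greedyRun {V : Type} (accept : V → Finset V → V → Prop) (S : Finset V) :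
    ∃ L, GreedyRun accept S L := by
  classical
  induction S using Finset.strongInduction with
  | H S ih =>
    rcases S.eq_empty_or_nonempty with rfl | ⟨v, hv⟩
    · exact ⟨[], GreedyRun.done⟩
    · have hlt : S \ growClass accept v (S.erase v).toList ⊂ S :=
        (Finset.ssubset_iff_of_subset Finset.sdiff_subset).2
          ⟨v, hv, fun h => (Finset.mem_sdiff.1 h).2 (mem_growClass _ _ _)⟩
      obtain ⟨L, hL⟩ := ih _ hlt
      refine ⟨_, GreedyRun.step (L := L) v (S.erase v).toList hv (Finset.nodup_toList _) ?_ ?_⟩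
      · intro w
        simp [and_comm]
      · convert hL

/-- GCC always terminates, so that it has an output on every instance. -/
theorem exists_isGCCOutput {n m B : ℕ} (C : CacheConfig n m B) (d : Demand n m) :
    ∃ L, IsGCCOutput C d L := by
  obtain ⟨L₁, h₁⟩ := exists_greedyRun (accept₁ C d) Finset.univ
  obtain ⟨L₂, h₂⟩ := exists_greedyRun (accept₂ C d) Finset.univ
  rcases le_total L₁.length L₂.length with h | h
  · exact ⟨L₁, L₁, L₂, h₁, h₂, Or.inl rfl, (min_eq_left h).symm⟩
  · exact ⟨L₂, L₁, L₂, h₁, h₂, Or.inr rfl, (min_eq_right h).symm⟩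

/-! ### Rates -/

/-- The conditional rate `E[N(C, d) | C] / B` of a delivery scheme that sends `N C d` coded packets
(colors); a random variable on the space of the pairs (cache configuration, demand). -/
noncomputable def condRate {m : ℕ} (n : ℕ) (q p : Fin m → ℝ) (M : ℝ) (B : ℕ)
    (N : CacheConfig n m B → Demand n m → ℕ) : CacheConfig n m B × Demand n m → ℝ :=
  fun ω => ((jointLaw n q p M B)[fun ω' => (N ω'.1 ω'.2 : ℝ) |
    MeasurableSpace.comap Prod.fst inferInstance]) ω / (B : ℝ)

/-- Number of colors used by chromatic-number index coding. -/
noncomputable def cicColors {n m B : ℕ} (C : CacheConfig n m B) (d : Demand n m) : ℕ :=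
  (conflictGraph C d).chromaticNumber.toNat

/-- `g_ℓ(j) = (p_j M)^(ℓ-1) (1 - p_j M)^(n-ℓ+1)`, for `1 ≤ ℓ ≤ n`. -/
noncomputable def g {m : ℕ} (n : ℕ) (p : Fin m → ℝ) (M : ℝ) (ℓ : ℕ) (j : Fin m) : ℝ :=
  (p j * M) ^ (ℓ - 1) * (1 - p j * M) ^ (n - ℓ + 1)

/-- `sel` is a version of "the" argmax: for each `1 ≤ ℓ ≤ n` and each `D = (D_1, …, D_ℓ)`, it picks an
entry of `D` that maximizes `g_ℓ` over the entries of `D` (ties are broken in any way). -/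
def IsArgmaxRule {m : ℕ} (n : ℕ) (p : Fin m → ℝ) (M : ℝ)
    (sel : (ℓ : ℕ) → (Fin ℓ → Fin m) → Fin m) : Prop :=
  ∀ ℓ, 1 ≤ ℓ → ℓ ≤ n → ∀ D : Fin ℓ → Fin m,
    (∃ i, sel ℓ D = D i) ∧ ∀ i, g n p M ℓ (D i) ≤ g n p M ℓ (sel ℓ D)

/-- `ρ_{f,ℓ}`: the probability that `f` is the argmax of `g_ℓ` over `ℓ` i.i.d. draws from `q`. -/
noncomputable def rho {m : ℕ} (q : Fin m → ℝ) (sel : (ℓ : ℕ) → (Fin ℓ → Fin m) → Fin m)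
    (f : Fin m) (ℓ : ℕ) : ℝ :=
  (requestsLaw q ℓ).real {D | sel ℓ D = f}

/-- `ψ(q, p)`. -/
noncomputable def psi {m : ℕ} (n : ℕ) (q p : Fin m → ℝ) (M : ℝ)
    (sel : (ℓ : ℕ) → (Fin ℓ → Fin m) → Fin m) : ℝ :=
  ∑ ℓ ∈ Finset.Icc 1 n, (n.choose ℓ : ℝ) * ∑ f : Fin m,
    rho q sel f ℓ * (p f * M) ^ (ℓ - 1) * (1 - p f * M) ^ (n - ℓ + 1)

/-- The expected number of distinct requested files. -/
noncomputable def mBar {m : ℕ} (n : ℕ) (q : Fin m → ℝ) : ℝ :=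
  ∑ f : Fin m, (1 - (1 - q f) ^ n)

end Caching

/-! Attach to each vertex the set T of users requesting or caching its packet. Two vertices with the
same T and different users never conflict, since each user caches the other's packet. So every class
of GCC₁ takes a vertex from each user still represented among the uncolored vertices of the root's
T, and T costs at most as many colors as its worst user u ∈ T has packets: those of the file of u
cached exactly by T \ {u} (`GreedyRun.length_le_of_accept₁`, `card_userClass_le`). GCC₂ uses at most
one color per packet of a requested file (`IsGCCOutput.length_le_card_image`).

With |T| = ℓ, the worst count is about B times the maximum of g_ℓ over the ℓ requests in T. Indeed
membership of two packets in a uniform subset of fixed size is negatively correlated, so Chebyshev's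
inequality and a union bound over the finitely many pairs (file, user set) control all counts at
once (`tendsto_placementLaw_typicalConfigs`).

On typical caches both bounds hold for every demand, so no concentration over demands is needed.
Averaging over demands turns the first bound into ψ (`integral_sum_maxG`) and the second into m̄
(`integral_card_image`). Both greedy colorings are proper, so the chromatic number obeys the same
bounds (`cicColors_le`). -/

namespace Caching

/-! ### Greedy colorings with an arbitrary acceptance test. -/

section Greedy

variable {V : Type} {accept : V → Finset V → V → Prop}

open Classical in
theorem subset_foldl_insert (P : Finset V → V → Prop) (l : List V) (I : Finset V) :
    I ⊆ l.foldl (fun I w => if P I w then insert w I else I) I := by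
  induction l generalizing I with
  | nil => exact subset_rfl
  | cons a l ih =>
    rw [List.foldl_cons]
    refine subset_trans ?_ (ih _)
    split_ifs
    · exact Finset.subset_insert _ _
    · exact subset_rfl

open Classical in
theorem foldl_insert_induction (P : Finset V → V → Prop) (Q : Finset V → Prop) (l : List V)
    (I : Finset V) (hI : Q I) (hstep : ∀ J, ∀ w ∈ l, Q J → P J w → Q (insert w J)) :
    Q (l.foldl (fun I w => if P I w then insert w I else I) I) := by
  induction l generalizing I with
  | nil => exact hI
  | cons a l ih =>
    rw [List.foldl_cons]
    refine ih _ ?_ fun J w hw => hstep J w (List.mem_cons_of_mem _ hw)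
    split_ifs with h
    · exact hstep _ _ List.mem_cons_self hI h
    · exact hI

-- The test on `w` is made against the set current at its visit; that set only grows afterwards, so
-- a rejecting set lies inside the final one.
open Classical in
theorem mem_or_exists_rejecting (P : Finset V → V → Prop) (l : List V) (I : Finset V)
    {w : V} (hw : w ∈ l) :
    w ∈ l.foldl (fun I w => if P I w then insert w I else I) I ∨
      ∃ J ⊆ l.foldl (fun I w => if P I w then insert w I else I) I, ¬ P J w := by
  induction l generalizing I with
  | nil => simp at hw
  | cons a l ih =>
    rw [List.foldl_cons]
    rcases List.mem_cons.1 hw with rfl | hw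
    · by_cases h : P I w
      · left
        apply subset_foldl_insert
        rw [if_pos h]
        exact Finset.mem_insert_self _ _
      · right
        refine ⟨I, ?_, h⟩
        rw [if_neg h]
        exact subset_foldl_insert _ _ _
    · exact ih _ hw

open Classical in
/-- Induction principle for the color class built by the inner loop. -/
theorem growClass_induction (v : V) (order : List V) (Q : Finset V → Prop) (hv : Q {v})
    -- `J'` stands for `J` with `w` added; only this inclusion is required, which can be stated
    -- without decidable equality.
    (hstep : ∀ J J' : Finset V, ∀ w ∈ order, (∀ x ∈ J', x = w ∨ x ∈ J) → Q J →
      accept v J w → Q J') :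
    Q (growClass accept v order) := by
  unfold growClass
  exact foldl_insert_induction _ Q order _ hv fun J w hw =>
    hstep J _ w hw fun x hx => Finset.mem_insert.1 hx

/-- A vertex visited by the inner loop is either taken or rejected by a part of the final class. -/
theorem mem_growClass_or_rejected (v : V) {order : List V} {w : V} (hw : w ∈ order) :
    w ∈ growClass accept v order ∨ ∃ J ⊆ growClass accept v order, ¬ accept v J w := by
  unfold growClass
  exact mem_or_exists_rejecting _ _ _ hw

theorem growClass_subset {v : V} {order : List V} {S : Finset V} (hv : v ∈ S)
    (horder : ∀ w, w ∈ order ↔ w ∈ S ∧ w ≠ v) : growClass accept v order ⊆ S := by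
  refine growClass_induction v order (· ⊆ S) (by simpa using hv) fun J J' w hw hJ' hJ _ x hx => ?_
  rcases hJ' x hx with rfl | hx
  · exact ((horder x).1 hw).1
  · exact hJ hx

open Classical in
/-- A potential that decreases at each round of the outer loop bounds the number of colors. -/
theorem GreedyRun.length_le (Φ : Finset V → ℕ)
    (hΦ : ∀ S S' v order, v ∈ S → (∀ w, w ∈ order ↔ w ∈ S ∧ w ≠ v) →
      (∀ w, w ∈ S' ↔ w ∈ S ∧ w ∉ growClass accept v order) → Φ S' < Φ S)
    {S : Finset V} {L : List (Finset V)} (h : GreedyRun accept S L) : L.length ≤ Φ S := by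
  induction h with
  | done => simp
  | @step S L v order hv _ horder _ ih =>
    rw [List.length_cons]
    exact Nat.succ_le_of_lt (ih.trans_lt (hΦ _ _ v order hv horder fun w => Finset.mem_sdiff))

/-- If every color class is independent, then a run gives a proper coloring. -/
theorem GreedyRun.cover (G : SimpleGraph V)
    (hind : ∀ v order, ∀ x ∈ growClass accept v order, ∀ y ∈ growClass accept v order,
      ¬ G.Adj x y) {S : Finset V} {L : List (Finset V)} (h : GreedyRun accept S L) :
    (∀ v ∈ S, ∃ i : Fin L.length, v ∈ L.get i) ∧
      ∀ I ∈ L, ∀ x ∈ I, ∀ y ∈ I, ¬ G.Adj x y := by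
  induction h with
  | done => simp
  | @step S L v order hv _ _ _ ih =>
    constructor
    · intro w hw
      by_cases hwI : w ∈ growClass accept v order
      · exact ⟨⟨0, by simp⟩, by simpa using hwI⟩
      · obtain ⟨i, hi⟩ := ih.1 w (by simp [hw, hwI])
        exact ⟨i.succ, by simpa using hi⟩
    · intro I hI
      rcases List.mem_cons.1 hI with rfl | hI
      · exact hind v order
      · exact ih.2 I hI

theorem GreedyRun.chromaticNumber_le [Fintype V] (G : SimpleGraph V)
    (hind : ∀ v order, ∀ x ∈ growClass accept v order, ∀ y ∈ growClass accept v order,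
      ¬ G.Adj x y) {L : List (Finset V)} (h : GreedyRun accept Finset.univ L) :
    G.chromaticNumber.toNat ≤ L.length := by
  obtain ⟨hcov, hI⟩ := h.cover G hind
  choose c hc using fun v => hcov v (Finset.mem_univ v)
  have hcol : G.Colorable L.length := by
    refine ⟨SimpleGraph.Coloring.mk c fun {v w} hvw heq => ?_⟩
    exact hI _ (List.get_mem L (c v)) v (hc v) w (heq ▸ hc w) hvw
  exact ENat.toNat_le_of_le_natCast hcol.chromaticNumber_le

end Greedy

/-! ### Color counts of GCC₁ and GCC₂ on the conflict graph. -/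

section Graph

variable {n m B : ℕ} {C : CacheConfig n m B} {d : Demand n m}

/-- The set of users requesting or caching the packet of a vertex. -/
def userSet (v : Vertex C d) : Finset (Fin n) := insert v.1.user v.1.cachers

open Classical in
theorem Vertex.exists_eq (v : Vertex C d) : ∃ x : Fin n × Fin B, x.2 ∉ C x.1 (d x.1) ∧
    v.1 = ⟨(d x.1, x.2), x.1, cachersOf C (d x.1, x.2)⟩ := by
  have h := v.2
  unfold labels at h
  obtain ⟨x, hx, hxv⟩ := Finset.mem_image.1 h
  exact ⟨x, (Finset.mem_filter.1 hx).2, hxv.symm⟩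

theorem Vertex.packet_fst (v : Vertex C d) : v.1.packet.1 = d v.1.user := by
  obtain ⟨x, _, hx⟩ := v.exists_eq
  rw [hx]

theorem Vertex.cachers_eq (v : Vertex C d) : v.1.cachers = cachersOf C v.1.packet := by
  obtain ⟨x, _, hx⟩ := v.exists_eq
  rw [hx]

theorem Vertex.user_notMem (v : Vertex C d) : v.1.user ∉ v.1.cachers := by
  obtain ⟨x, h, hx⟩ := v.exists_eq
  rw [hx]
  simpa [cachersOf] using h

/-- If the users differ, each lies in the common set without being the other's requester, hence
caches the other's packet, and both alternatives of the conflict condition fail. -/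
theorem user_eq_of_adj {v w : Vertex C d} (h : (conflictGraph C d).Adj v w)
    (hT : userSet v = userSet w) : v.1.user = w.1.user := by
  by_contra hne
  have h1 : v.1.user ∈ userSet w := hT ▸ Finset.mem_insert_self _ _
  have h2 : w.1.user ∈ userSet v := hT ▸ Finset.mem_insert_self _ _
  have h1 := (Finset.mem_insert.1 h1).resolve_left hne
  have h2 := (Finset.mem_insert.1 h2).resolve_left (Ne.symm hne)
  exact h.2.elim (fun h => h h1) (fun h => h h2)

theorem growClass_accept₁_userSet (v : Vertex C d) (order : List (Vertex C d)) :
    ∀ x ∈ growClass (accept₁ C d) v order, userSet x = userSet v := by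
  refine growClass_induction v order (fun I => ∀ x ∈ I, userSet x = userSet v) (by simp) ?_
  intro J J' w _ hJ' hJ hacc x hx
  rcases hJ' x hx with rfl | hx
  · exact hacc.2
  · exact hJ x hx

theorem growClass_accept₁_indep (v : Vertex C d) (order : List (Vertex C d)) :
    ∀ x ∈ growClass (accept₁ C d) v order, ∀ y ∈ growClass (accept₁ C d) v order,
      ¬ (conflictGraph C d).Adj x y := by
  refine growClass_induction v order
    (fun I => ∀ x ∈ I, ∀ y ∈ I, ¬ (conflictGraph C d).Adj x y) (by simp) ?_
  intro J J' w _ hJ' hJ hacc x hx y hy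
  rcases hJ' x hx with rfl | hx <;> rcases hJ' y hy with hyw | hy
  · exact hyw ▸ (conflictGraph C d).irrefl
  · exact hacc.1 y hy
  · exact fun h => hacc.1 x hx (hyw ▸ h.symm)
  · exact hJ x hx y hy

theorem growClass_accept₂_packet (v : Vertex C d) (order : List (Vertex C d)) :
    ∀ x ∈ growClass (accept₂ C d) v order, x.1.packet = v.1.packet := by
  refine growClass_induction v order (fun I => ∀ x ∈ I, x.1.packet = v.1.packet) (by simp) ?_
  intro J J' w _ hJ' hJ hacc x hx
  rcases hJ' x hx with rfl | hx
  · exact hacc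
  · exact hJ x hx

theorem growClass_accept₂_indep (v : Vertex C d) (order : List (Vertex C d)) :
    ∀ x ∈ growClass (accept₂ C d) v order, ∀ y ∈ growClass (accept₂ C d) v order,
      ¬ (conflictGraph C d).Adj x y := fun x hx y hy h =>
  h.1 ((growClass_accept₂_packet v order x hx).trans
    (growClass_accept₂_packet v order y hy).symm)

/-- Chromatic-number index coding never needs more colors than GCC. -/
theorem cicColors_le {L : List (Finset (Vertex C d))} (h : IsGCCOutput C d L) :
    cicColors C d ≤ L.length := by
  obtain ⟨L₁, L₂, h₁, h₂, rfl | rfl, _⟩ := h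
  · exact h₁.chromaticNumber_le _ growClass_accept₁_indep
  · exact h₂.chromaticNumber_le _ growClass_accept₂_indep

/-- The vertices of `S` of user `u` with set `T` of requesting or caching users. -/
noncomputable def userClass (S : Finset (Vertex C d)) (T : Finset (Fin n)) (u : Fin n) :
    Finset (Vertex C d) := by
  classical exact S.filter fun v => v.1.user = u ∧ userSet v = T

theorem mem_userClass {S : Finset (Vertex C d)} {T : Finset (Fin n)} {u : Fin n}
    {v : Vertex C d} : v ∈ userClass S T u ↔ v ∈ S ∧ v.1.user = u ∧ userSet v = T := by
  simp [userClass]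

/-- If `w` is rejected although its user set is that of the root, it has a neighbor in the class
with the same user set; by `user_eq_of_adj` that neighbor belongs to the same user. -/
theorem growClass_accept₁_hits {v w : Vertex C d} {order : List (Vertex C d)}
    {S : Finset (Vertex C d)} (horder : ∀ w, w ∈ order ↔ w ∈ S ∧ w ≠ v) (hw : w ∈ S)
    (hT : userSet w = userSet v) :
    ∃ x ∈ growClass (accept₁ C d) v order, x.1.user = w.1.user := by
  by_cases hwv : w = v
  · exact ⟨v, mem_growClass _ _ _, by rw [hwv]⟩
  rcases mem_growClass_or_rejected (accept := accept₁ C d) v ((horder w).2 ⟨hw, hwv⟩) with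
    h | ⟨J, hJ, hrej⟩
  · exact ⟨w, h, rfl⟩
  · have : ∃ x ∈ J, (conflictGraph C d).Adj w x := by
      by_contra! hno
      exact hrej ⟨hno, hT⟩
    obtain ⟨x, hx, hadj⟩ := this
    refine ⟨x, hJ hx, (user_eq_of_adj hadj ?_).symm⟩
    rw [hT, growClass_accept₁_userSet v order x (hJ hx)]

/-- The potential is, summed over T, the largest number of uncolored vertices of one user. A round
takes a vertex from every user still present in the root's T, so that maximum drops, and no other
term increases. -/
theorem GreedyRun.length_le_of_accept₁ {S : Finset (Vertex C d)} {L : List (Finset (Vertex C d))}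
    (h : GreedyRun (accept₁ C d) S L) :
    L.length ≤ ∑ T : Finset (Fin n), T.sup fun u => (userClass S T u).card := by
  classical
  refine h.length_le (fun S => ∑ T : Finset (Fin n), T.sup fun u => (userClass S T u).card) ?_
  · intro S S' v order hv horder hS'
    refine Finset.sum_lt_sum (fun T _ => ?_) ⟨userSet v, Finset.mem_univ _, ?_⟩
    · refine Finset.sup_mono_fun fun u _ => Finset.card_le_card fun w hw => ?_
      rw [mem_userClass] at hw ⊢
      exact ⟨((hS' w).1 hw.1).1, hw.2⟩
    · have hpos : 0 < (userClass S (userSet v) v.1.user).card :=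
        Finset.card_pos.2 ⟨v, mem_userClass.2 ⟨hv, rfl, rfl⟩⟩
      have hle : ∀ u ∈ userSet v, (userClass S (userSet v) u).card ≤
          (userSet v).sup fun u => (userClass S (userSet v) u).card := fun u hu =>
        Finset.le_sup (f := fun u => (userClass S (userSet v) u).card) hu
      -- A strict bound on a supremum requires the bound to exceed `⊥ = 0`; the root provides this.
      -- Positivity also settles the users with no vertex left, who lose nothing.
      rw [Finset.sup_lt_iff (hpos.trans_le (hle _ (Finset.mem_insert_self _ _)))]
      intro u hu
      rcases (userClass S (userSet v) u).eq_empty_or_nonempty with hemp | ⟨w, hw⟩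
      · refine lt_of_eq_of_lt ?_ (hpos.trans_le (hle _ (Finset.mem_insert_self _ _)))
        rw [Finset.card_eq_zero, Finset.eq_empty_iff_forall_notMem]
        intro w hw
        rw [mem_userClass] at hw
        have : w ∈ userClass S (userSet v) u :=
          mem_userClass.2 ⟨((hS' w).1 hw.1).1, hw.2⟩
        simp [hemp] at this
      · rw [mem_userClass] at hw
        obtain ⟨x, hx, hxu⟩ := growClass_accept₁_hits horder hw.1 hw.2.2
        refine lt_of_lt_of_le (Finset.card_lt_card ?_) (hle u hu)
        rw [Finset.ssubset_iff_of_subset]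
        · refine ⟨x, mem_userClass.2 ⟨growClass_subset hv horder hx, hxu.trans hw.2.1,
            growClass_accept₁_userSet v order x hx⟩, fun h => ?_⟩
          exact ((hS' x).1 (mem_userClass.1 h).1).2 hx
        · intro y hy
          rw [mem_userClass] at hy ⊢
          exact ⟨((hS' y).1 hy.1).1, hy.2⟩

/-- The number of packets of file `f` that are cached exactly by the users in `A`. -/
def exactCount (C : CacheConfig n m B) (f : Fin m) (A : Finset (Fin n)) : ℕ :=
  (Finset.univ.filter fun b : Fin B => cachersOf C (f, b) = A).card

/-- The requester is never a cacher, so the cachers are exactly `T.erase u`; the file being `d u`,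
the packet index determines the vertex. -/
theorem card_userClass_le (S : Finset (Vertex C d)) (T : Finset (Fin n)) (u : Fin n) :
    (userClass S T u).card ≤ exactCount C (d u) (T.erase u) := by
  classical
  refine Finset.card_le_card_of_injOn (fun v => v.1.packet.2) ?_ ?_
  · intro v hv
    obtain ⟨-, rfl, rfl⟩ := mem_userClass.1 (Finset.mem_coe.1 hv)
    rw [Finset.mem_coe, Finset.mem_filter]
    refine ⟨Finset.mem_univ _, ?_⟩
    rw [← v.packet_fst, Prod.mk.eta, ← v.cachers_eq, userSet, Finset.erase_insert v.user_notMem]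
  · intro v hv w hw hvw
    obtain ⟨-, hvu, -⟩ := mem_userClass.1 (Finset.mem_coe.1 hv)
    obtain ⟨-, hwu, -⟩ := mem_userClass.1 (Finset.mem_coe.1 hw)
    have hu : v.1.user = w.1.user := hvu.trans hwu.symm
    have hp : v.1.packet = w.1.packet :=
      Prod.ext (by rw [v.packet_fst, w.packet_fst, hu]) hvw
    exact Subtype.ext (Label.ext hp hu (by rw [v.cachers_eq, w.cachers_eq, hp]))

/-- The test ignores the current class, so a round exhausts the root's packet and the number of
distinct uncolored packets drops. -/
theorem GreedyRun.length_le_of_accept₂ {S : Finset (Vertex C d)} {L : List (Finset (Vertex C d))}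
    (h : GreedyRun (accept₂ C d) S L) :
    L.length ≤ (S.image fun v => v.1.packet).card := by
  classical
  refine h.length_le (fun S => (S.image fun v => v.1.packet).card) ?_
  · intro S S' v order hv horder hS'
    refine Finset.card_lt_card ?_
    rw [Finset.ssubset_iff_of_subset
      (Finset.image_subset_image fun w hw => ((hS' w).1 hw).1)]
    refine ⟨v.1.packet, Finset.mem_image_of_mem _ hv, fun hmem => ?_⟩
    obtain ⟨w, hw, hwv⟩ := Finset.mem_image.1 hmem
    rw [hS'] at hw
    by_cases hne : w = v
    · exact hw.2 (hne ▸ mem_growClass _ _ _)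
    rcases mem_growClass_or_rejected (accept := accept₂ C d) v ((horder w).2 ⟨hw.1, hne⟩) with
      h | ⟨J, _, hrej⟩
    · exact hw.2 h
    · exact hrej hwv

theorem IsGCCOutput.length_le_sum {L : List (Finset (Vertex C d))} (h : IsGCCOutput C d L) :
    L.length ≤ ∑ T : Finset (Fin n), T.sup fun u => exactCount C (d u) (T.erase u) := by
  obtain ⟨L₁, L₂, h₁, -, -, hlen⟩ := h
  rw [hlen]
  refine (min_le_left _ _).trans (h₁.length_le_of_accept₁.trans ?_)
  exact Finset.sum_le_sum fun T _ => Finset.sup_mono_fun fun u _ => card_userClass_le _ _ _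

theorem IsGCCOutput.length_le_card_image {L : List (Finset (Vertex C d))}
    (h : IsGCCOutput C d L) : L.length ≤ (Finset.univ.image d).card * B := by
  classical
  obtain ⟨L₁, L₂, -, h₂, -, hlen⟩ := h
  rw [hlen]
  refine (min_le_right _ _).trans (h₂.length_le_of_accept₂.trans ?_)
  have hsub : (Finset.univ.image fun v : Vertex C d => v.1.packet) ⊆
      (Finset.univ.image d) ×ˢ (Finset.univ : Finset (Fin B)) := by
    intro x hx
    obtain ⟨v, -, rfl⟩ := Finset.mem_image.1 hx
    simp [v.packet_fst]
  simpa using Finset.card_le_card hsub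

end Graph

instance (B : ℕ) : DiscreteMeasurableSpace (Finset (Fin B)) := ⟨fun _ => trivial⟩

/-! ### Inclusion probabilities in a uniform subset of fixed size. -/

section SubsetSampling

variable {B k : ℕ}

theorem isProbabilityMeasure_uniformOn_card (hk : k ≤ B) :
    IsProbabilityMeasure (uniformOn {S : Finset (Fin B) | S.card = k}) := by
  refine isProbabilityMeasure_uniformOn (Set.toFinite _) ?_
  obtain ⟨S, -, hS⟩ := Finset.exists_subset_card_eq (s := (Finset.univ : Finset (Fin B))) (n := k)
    (by simpa using hk)
  exact ⟨S, hS⟩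

theorem uniformOn_card_real (P : Finset (Fin B) → Prop) [DecidablePred P] :
    (uniformOn {S : Finset (Fin B) | S.card = k}).real {S | P S} =
      (((Finset.powersetCard k Finset.univ).filter P).card : ℝ) / (B.choose k : ℝ) := by
  have h1 : {S : Finset (Fin B) | S.card = k} =
      ((Finset.powersetCard k Finset.univ : Finset (Finset (Fin B))) : Set (Finset (Fin B))) := by
    ext S; simp [Finset.mem_powersetCard]
  have h2 : {S : Finset (Fin B) | P S} =
      ((Finset.univ.filter P : Finset (Finset (Fin B))) : Set (Finset (Fin B))) := by
    ext S; simp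
  rw [measureReal_def, h1, h2, uniformOn_apply_finset, ENNReal.toReal_div]
  simp [Finset.inter_filter]

theorem card_filter_disjoint (A : Finset (Fin B)) :
    ((Finset.powersetCard k Finset.univ).filter fun S => Disjoint A S).card =
      (B - A.card).choose k := by
  have : ((Finset.powersetCard k Finset.univ).filter fun S => Disjoint A S) =
      Finset.powersetCard k Aᶜ := by
    ext S
    simp [Finset.mem_powersetCard, and_comm, Finset.subset_compl_iff_disjoint_left]
  rw [this, Finset.card_powersetCard, Finset.card_compl, Fintype.card_fin]

/-- Complementation turns supersets of `A` of size `k` into sets of size `B - k` disjoint from `A`.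
-/
theorem card_filter_superset (hk : k ≤ B) (A : Finset (Fin B)) :
    ((Finset.powersetCard k Finset.univ).filter fun S => A ⊆ S).card =
      (B - A.card).choose (B - k) := by
  rw [← card_filter_disjoint]
  refine Finset.card_bij (fun S _ => Sᶜ) ?_ (fun S _ T _ h => compl_injective h) ?_
  · intro S hS
    simp only [Finset.mem_filter, Finset.mem_powersetCard_univ] at hS ⊢
    refine ⟨by rw [Finset.card_compl, Fintype.card_fin, hS.1], ?_⟩
    exact Finset.disjoint_left.2 fun x hx hxS => Finset.mem_compl.1 hxS (hS.2 hx)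
  · intro T hT
    simp only [Finset.mem_filter, Finset.mem_powersetCard_univ] at hT
    refine ⟨Tᶜ, ?_, compl_compl T⟩
    simp only [Finset.mem_filter, Finset.mem_powersetCard_univ]
    refine ⟨by rw [Finset.card_compl, Fintype.card_fin, hT.1]; omega, ?_⟩
    exact fun x hx => Finset.mem_compl.2 (Finset.disjoint_left.1 hT.2 hx)

theorem choose_pred_div (hk : k ≤ B) (hB : 0 < B) :
    ((B - 1).choose k : ℝ) / (B.choose k : ℝ) = 1 - (k : ℝ) / B := by
  obtain ⟨c, rfl⟩ : ∃ c, B = c + 1 := ⟨B - 1, by omega⟩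
  have h := Nat.choose_mul_succ_eq c k
  have hpos : (0 : ℝ) < ((c + 1).choose k : ℝ) := by exact_mod_cast Nat.choose_pos hk
  have h' : (c.choose k : ℝ) * ((c : ℝ) + 1) = ((c + 1).choose k : ℝ) * ((c : ℝ) + 1 - k) := by
    have := congrArg (Nat.cast (R := ℝ)) h
    push_cast [Nat.cast_sub hk] at this
    exact this
  have hc : (0 : ℝ) < (c : ℝ) + 1 := by positivity
  rw [Nat.add_sub_cancel, div_eq_iff hpos.ne']
  push_cast
  field_simp
  linarith

/-- This is the negative correlation: the chance of avoiding a second point, given that the first is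
avoided, is 1 - k/(B-1), at most 1 - k/B. -/
theorem choose_pred_pred_div_le (hk : k ≤ B) (hB : 2 ≤ B) :
    ((B - 2).choose k : ℝ) / (B.choose k : ℝ) ≤ (1 - (k : ℝ) / B) ^ 2 := by
  have hB0 : (0 : ℝ) < B := by exact_mod_cast (by omega : 0 < B)
  have hnn : (0 : ℝ) ≤ 1 - (k : ℝ) / B := by
    rw [sub_nonneg, div_le_one hB0]; exact_mod_cast hk
  -- When k = B the intermediate factor `(B - 1).choose k` vanishes and cannot be divided by.
  rcases hk.eq_or_lt with rfl | hlt
  · rw [Nat.choose_eq_zero_of_lt (by omega)]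
    simpa using sq_nonneg _
  have h1 := choose_pred_div hk (by omega)
  have h2 := choose_pred_div (B := B - 1) (k := k) (by omega) (by omega)
  have hpos : (0 : ℝ) < ((B - 1).choose k : ℝ) := by
    exact_mod_cast Nat.choose_pos (by omega : k ≤ B - 1)
  have hB1 : (0 : ℝ) < ((B - 1 : ℕ) : ℝ) := by exact_mod_cast (by omega : 0 < B - 1)
  have hle : 1 - (k : ℝ) / ((B - 1 : ℕ) : ℝ) ≤ 1 - (k : ℝ) / B := by
    have : ((B - 1 : ℕ) : ℝ) ≤ B := by exact_mod_cast Nat.sub_le B 1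
    gcongr
  calc ((B - 2).choose k : ℝ) / (B.choose k : ℝ)
      = ((B - 1 - 1).choose k : ℝ) / ((B - 1).choose k : ℝ) *
          (((B - 1).choose k : ℝ) / (B.choose k : ℝ)) := by
        rw [div_mul_div_cancel₀ hpos.ne', Nat.sub_sub]
    _ ≤ (1 - (k : ℝ) / B) ^ 2 := by
        rw [h1, h2, sq]; gcongr

theorem one_sub_compl_div (hk : k ≤ B) (hB : 0 < B) :
    1 - ((B - k : ℕ) : ℝ) / B = (k : ℝ) / B := by
  have hB0 : (0 : ℝ) < B := by exact_mod_cast hB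
  rw [Nat.cast_sub hk]
  field_simp
  ring

/-- The probability that a given packet is (`P`) or is not (`¬ P`) in a uniform `k`-subset. -/
theorem uniformOn_card_real_mem_iff (hk : k ≤ B) (b : Fin B) (P : Prop) [Decidable P] :
    (uniformOn {S : Finset (Fin B) | S.card = k}).real {S | b ∈ S ↔ P} =
      if P then (k : ℝ) / B else 1 - (k : ℝ) / B := by
  have hB : 0 < B := b.pos
  split_ifs with h
  · have : {S : Finset (Fin B) | b ∈ S ↔ P} = {S | {b} ⊆ S} := by ext S; simp [h]
    rw [this, uniformOn_card_real, card_filter_superset hk, Finset.card_singleton,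
      ← Nat.choose_symm hk, choose_pred_div (Nat.sub_le _ _) hB, one_sub_compl_div hk hB]
  · have : {S : Finset (Fin B) | b ∈ S ↔ P} = {S | Disjoint {b} S} := by ext S; simp [h]
    rw [this, uniformOn_card_real, card_filter_disjoint, Finset.card_singleton,
      choose_pred_div hk hB]

/-- Membership of two distinct packets in a uniform `k`-subset is negatively correlated. -/
theorem uniformOn_card_real_pair_le (hk : k ≤ B) {b b' : Fin B} (hb : b ≠ b') (P : Prop)
    [Decidable P] :
    (uniformOn {S : Finset (Fin B) | S.card = k}).real {S | (b ∈ S ↔ P) ∧ (b' ∈ S ↔ P)} ≤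
      (if P then (k : ℝ) / B else 1 - (k : ℝ) / B) ^ 2 := by
  have hB : 0 < B := b.pos
  have hcard : ({b, b'} : Finset (Fin B)).card = 2 := Finset.card_pair hb
  have hB2 : 2 ≤ B := by
    simpa [hcard] using Finset.card_le_univ ({b, b'} : Finset (Fin B))
  split_ifs with h
  · have : {S : Finset (Fin B) | (b ∈ S ↔ P) ∧ (b' ∈ S ↔ P)} = {S | {b, b'} ⊆ S} := by
      ext S; simp [h, Finset.insert_subset_iff]
    rw [this, uniformOn_card_real, card_filter_superset hk, hcard, ← Nat.choose_symm hk,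
      ← one_sub_compl_div hk hB]
    exact choose_pred_pred_div_le (Nat.sub_le _ _) hB2
  · have : {S : Finset (Fin B) | (b ∈ S ↔ P) ∧ (b' ∈ S ↔ P)} = {S | Disjoint {b, b'} S} := by
      ext S; simp [h]
    rw [this, uniformOn_card_real, card_filter_disjoint, hcard]
    exact choose_pred_pred_div_le hk hB2

end SubsetSampling

/-- Chebyshev's inequality for the number of occurrences among equiprobable, pairwise negatively
correlated events. -/
theorem real_abs_card_sub_ge_le {Ω : Type*} [Finite Ω] [MeasurableSpace Ω]
    [DiscreteMeasurableSpace Ω] (μ : Measure Ω) [IsProbabilityMeasure μ] {B : ℕ} (hB : 0 < B)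
    (E : Ω → Fin B → Prop) [∀ ω, DecidablePred (E ω)] (s : ℝ)
    (h1 : ∀ b, μ.real {ω | E ω b} = s)
    (h2 : ∀ b b', b ≠ b' → μ.real {ω | E ω b ∧ E ω b'} ≤ s ^ 2) {δ : ℝ} (hδ : 0 < δ) :
    μ.real {ω | δ * B ≤ |((Finset.univ.filter (E ω)).card : ℝ) - B * s|} ≤ 1 / (δ ^ 2 * B) := by
  have hB0 : (0 : ℝ) < B := by exact_mod_cast hB
  let X : Fin B → Ω → ℝ := fun b => Set.indicator {ω | E ω b} 1
  have hX1 : ∀ b, ∫ ω, X b ω ∂μ = s := fun b => by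
    rw [integral_indicator_one .of_discrete, h1]
  have hX2 : ∀ b b', ∫ ω, X b ω * X b' ω ∂μ = μ.real {ω | E ω b ∧ E ω b'} := fun b b' => by
    rw [← integral_indicator_one .of_discrete]
    refine integral_congr_ae (.of_forall fun ω => ?_)
    by_cases h : E ω b <;> by_cases h' : E ω b' <;> simp [X, Set.indicator, h, h']
  have hcov : ∀ b b', ∫ ω, (X b ω - s) * (X b' ω - s) ∂μ = μ.real {ω | E ω b ∧ E ω b'} - s ^ 2 := by
    intro b b'
    have : ∀ ω, (X b ω - s) * (X b' ω - s) = X b ω * X b' ω - s * X b ω - s * X b' ω + s ^ 2 :=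
      fun ω => by ring
    simp_rw [this]
    rw [integral_add .of_finite .of_finite, integral_sub .of_finite .of_finite,
      integral_sub .of_finite .of_finite, integral_const_mul, integral_const_mul, hX1, hX1, hX2]
    simp
    ring
  have hsum : ∀ ω, (((Finset.univ.filter (E ω)).card : ℝ) - B * s) ^ 2 =
      ∑ b, ∑ b', (X b ω - s) * (X b' ω - s) := by
    intro ω
    rw [← Finset.sum_mul_sum, ← sq]
    simp [X, Set.indicator, Finset.sum_sub_distrib]
  -- The variance is at most B: off-diagonal covariances are nonpositive and each of the B diagonal
  -- terms is at most 1.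
  have hint : ∫ ω, (((Finset.univ.filter (E ω)).card : ℝ) - B * s) ^ 2 ∂μ ≤ B := by
    simp_rw [hsum]
    rw [integral_finsetSum _ fun _ _ => .of_finite]
    refine (Finset.sum_le_card_nsmul Finset.univ _ 1 fun b _ => ?_).trans_eq (by simp)
    rw [integral_finsetSum _ fun _ _ => .of_finite]
    rw [← Finset.add_sum_erase _ _ (Finset.mem_univ b)]
    have hoff : ∑ b' ∈ Finset.univ.erase b, ∫ ω, (X b ω - s) * (X b' ω - s) ∂μ ≤ 0 :=
      Finset.sum_nonpos fun b' hb' => by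
        rw [hcov, sub_nonpos]
        exact h2 b b' (Finset.ne_of_mem_erase hb').symm
    have hdiag : ∫ ω, (X b ω - s) * (X b ω - s) ∂μ ≤ 1 := by
      rw [hcov]
      have : μ.real {ω | E ω b ∧ E ω b} ≤ 1 := measureReal_le_one
      nlinarith [sq_nonneg s]
    linarith
  have hmarkov := mul_meas_ge_le_integral_of_nonneg (μ := μ)
    (f := fun ω => (((Finset.univ.filter (E ω)).card : ℝ) - B * s) ^ 2)
    (.of_forall fun ω => sq_nonneg _) .of_finite ((δ * B) ^ 2)
  have hset : {ω | δ * B ≤ |((Finset.univ.filter (E ω)).card : ℝ) - B * s|} =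
      {ω | (δ * B) ^ 2 ≤ (((Finset.univ.filter (E ω)).card : ℝ) - B * s) ^ 2} := by
    ext ω
    rw [Set.mem_ofPred_eq, Set.mem_ofPred_eq, sq_le_sq, abs_of_pos (by positivity : 0 < δ * B)]
  rw [hset, le_div_iff₀ (by positivity)]
  have := hmarkov.trans hint
  refine le_of_mul_le_mul_right ?_ hB0
  linarith [this]

/-! ### Concentration of the cache configuration. -/

section Placement

variable {n m : ℕ} {p : Fin m → ℝ} {M : ℝ} {B : ℕ}

theorem floor_le (hpM : ∀ f, p f * M ≤ 1) (f : Fin m) : ⌊p f * M * (B : ℝ)⌋₊ ≤ B := by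
  refine Nat.floor_le_of_le ?_
  have : (0 : ℝ) ≤ B := B.cast_nonneg
  nlinarith [hpM f]

theorem isProbabilityMeasure_placementLaw (hpM : ∀ f, p f * M ≤ 1) :
    IsProbabilityMeasure (placementLaw n p M B) := by
  have := fun f => isProbabilityMeasure_uniformOn_card (floor_le (p := p) (M := M) (B := B) hpM f)
  unfold placementLaw
  infer_instance

theorem placementLaw_real_forall (hpM : ∀ f, p f * M ≤ 1) (f : Fin m)
    (A : Fin n → Set (Finset (Fin B))) :
    (placementLaw n p M B).real {C | ∀ u, C u f ∈ A u} =
      ∏ u, (uniformOn {S : Finset (Fin B) | S.card = ⌊p f * M * (B : ℝ)⌋₊}).real (A u) := by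
  have := fun f => isProbabilityMeasure_uniformOn_card (floor_le (p := p) (M := M) (B := B) hpM f)
  have hset : {C : CacheConfig n m B | ∀ u, C u f ∈ A u} =
      Set.pi Set.univ fun u => Function.eval f ⁻¹' A u := by
    ext C; simp
  unfold placementLaw
  rw [measureReal_def, hset, Measure.pi_pi, ENNReal.toReal_prod]
  refine Finset.prod_congr rfl fun u _ => ?_
  rw [(measurePreserving_eval _ f).measure_preimage (MeasurableSet.of_discrete).nullMeasurableSet,
    measureReal_def]

theorem cachersOf_eq_iff {C : CacheConfig n m B} {f : Fin m} {b : Fin B} {A : Finset (Fin n)} :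
    cachersOf C (f, b) = A ↔ ∀ u, b ∈ C u f ↔ u ∈ A := by
  simp [cachersOf, Finset.ext_iff]

theorem prod_ite_mem (A : Finset (Fin n)) (x y : ℝ) :
    ∏ u, (if u ∈ A then x else y) = x ^ A.card * y ^ (n - A.card) := by
  rw [Finset.prod_ite]
  simp [Finset.filter_not, Finset.card_sdiff]

/-- Concentration of the number of packets of `f` cached exactly by the users in `A`. -/
theorem placementLaw_real_exactCount_le (hpM : ∀ f, p f * M ≤ 1) (hB : 0 < B) (f : Fin m)
    (A : Finset (Fin n)) {δ : ℝ} (hδ : 0 < δ) :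
    (placementLaw n p M B).real {C | δ * B ≤ |(exactCount C f A : ℝ) -
      B * (((⌊p f * M * (B : ℝ)⌋₊ : ℝ) / B) ^ A.card *
        (1 - (⌊p f * M * (B : ℝ)⌋₊ : ℝ) / B) ^ (n - A.card))|} ≤ 1 / (δ ^ 2 * B) := by
  have := isProbabilityMeasure_placementLaw (n := n) (p := p) (M := M) (B := B) hpM
  refine real_abs_card_sub_ge_le _ hB (fun C b => cachersOf C (f, b) = A) _ ?_ ?_ hδ
  · intro b
    simp_rw [cachersOf_eq_iff]
    have := placementLaw_real_forall (n := n) (p := p) (M := M) (B := B) hpM f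
      fun u => {S | b ∈ S ↔ u ∈ A}
    simp only [Set.mem_ofPred_eq] at this
    rw [this, ← prod_ite_mem]
    exact Finset.prod_congr rfl fun u _ => uniformOn_card_real_mem_iff (floor_le hpM f) b _
  · intro b b' hb
    simp_rw [cachersOf_eq_iff, ← forall_and]
    have := placementLaw_real_forall (n := n) (p := p) (M := M) (B := B) hpM f
      fun u => {S | (b ∈ S ↔ u ∈ A) ∧ (b' ∈ S ↔ u ∈ A)}
    simp only [Set.mem_ofPred_eq] at this
    rw [this, ← prod_ite_mem, ← Finset.prod_pow]
    -- By independence over users, both sides factor, and the inequality is the negative correlation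
    -- within each single cache.
    exact Finset.prod_le_prod (fun u _ => measureReal_nonneg) fun u _ =>
      uniformOn_card_real_pair_le (floor_le hpM f) hb _

theorem tendsto_floor_div {B : ℕ → ℕ} (hB : Tendsto B atTop atTop) {a : ℝ} (ha : 0 ≤ a) :
    Tendsto (fun F => (⌊a * (B F : ℝ)⌋₊ : ℝ) / B F) atTop (𝓝 a) :=
  (tendsto_nat_floor_mul_div_atTop ha).comp (tendsto_natCast_atTop_atTop.comp hB)

/-- The cache configurations in which no count of packets cached exactly by a given set of users
exceeds its asymptotic mean by more than `δ B`. -/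
def typicalConfigs (n : ℕ) {m : ℕ} (p : Fin m → ℝ) (M : ℝ) (B : ℕ) (δ : ℝ) :
    Set (CacheConfig n m B) :=
  {C | ∀ f A, (exactCount C f A : ℝ) ≤
    B * ((p f * M) ^ A.card * (1 - p f * M) ^ (n - A.card) + δ)}

/-- Half of δ absorbs the rounding of the cache sizes, for large B; the other half is the deviation
allowed in Chebyshev's inequality. The number of pairs (f, A) is fixed, so the union bound still
tends to 0. -/
theorem tendsto_placementLaw_typicalConfigs (hM : 0 ≤ M) (hp : ∀ f, 0 ≤ p f)
    (hpM : ∀ f, p f * M ≤ 1) {B : ℕ → ℕ} (hB : Tendsto B atTop atTop) {δ : ℝ} (hδ : 0 < δ) :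
    Tendsto (fun F => (placementLaw n p M (B F)).real (typicalConfigs n p M (B F) δ))
      atTop (𝓝 1) := by
  have hprob := fun F => isProbabilityMeasure_placementLaw (n := n) (p := p) (M := M) (B := B F) hpM
  have hs : ∀ (f : Fin m) (A : Finset (Fin n)), ∀ᶠ F in atTop,
      ((⌊p f * M * (B F : ℝ)⌋₊ : ℝ) / B F) ^ A.card *
        (1 - (⌊p f * M * (B F : ℝ)⌋₊ : ℝ) / B F) ^ (n - A.card) ≤
      (p f * M) ^ A.card * (1 - p f * M) ^ (n - A.card) + δ / 2 := by
    intro f A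
    have h := tendsto_floor_div hB (mul_nonneg (hp f) hM)
    have := (h.pow A.card).mul ((tendsto_const_nhds (x := (1 : ℝ)).sub h).pow (n - A.card))
    exact this.eventually_le_const (by linarith)
  have hev : ∀ᶠ F in atTop, 1 - (∑ _x : Fin m × Finset (Fin n), 1 / ((δ / 2) ^ 2 * (B F : ℝ))) ≤
      (placementLaw n p M (B F)).real (typicalConfigs n p M (B F) δ) := by
    have hs' : ∀ᶠ F in atTop, ∀ x : Fin m × Finset (Fin n), _ :=
      eventually_all.2 fun x => hs x.1 x.2
    filter_upwards [hs', hB.eventually_gt_atTop 0] with F hF hBF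
    have hB0 : (0 : ℝ) < B F := by exact_mod_cast hBF
    have hcompl := probReal_compl_eq_one_sub (μ := placementLaw n p M (B F))
      (s := typicalConfigs n p M (B F) δ) .of_discrete
    have hsub : (typicalConfigs n p M (B F) δ)ᶜ ⊆ ⋃ x : Fin m × Finset (Fin n),
        {C | δ / 2 * B F ≤ |(exactCount C x.1 x.2 : ℝ) -
          B F * (((⌊p x.1 * M * (B F : ℝ)⌋₊ : ℝ) / B F) ^ x.2.card *
            (1 - (⌊p x.1 * M * (B F : ℝ)⌋₊ : ℝ) / B F) ^ (n - x.2.card))|} := by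
      intro C hC
      simp only [typicalConfigs, Set.mem_compl_iff, Set.mem_ofPred_eq, not_forall, not_le] at hC
      obtain ⟨f, A, hfA⟩ := hC
      refine Set.mem_iUnion.2 ⟨(f, A), ?_⟩
      rw [Set.mem_ofPred_eq]
      refine le_trans ?_ (le_abs_self _)
      have := mul_le_mul_of_nonneg_left (hF (f, A)) hB0.le
      dsimp only at this ⊢
      linarith
    have := (measureReal_mono hsub).trans ((measureReal_iUnion_fintype_le _).trans
      (Finset.sum_le_sum fun x _ =>
        placementLaw_real_exactCount_le (n := n) hpM hBF x.1 x.2 (half_pos hδ)))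
    linarith
  refine tendsto_of_tendsto_of_tendsto_of_le_of_le' ?_ tendsto_const_nhds hev
    (.of_forall fun F => measureReal_le_one)
  have hB' : Tendsto (fun F => (B F : ℝ)) atTop atTop := tendsto_natCast_atTop_atTop.comp hB
  have : Tendsto (fun F => 1 / ((δ / 2) ^ 2 * (B F : ℝ))) atTop (𝓝 0) :=
    tendsto_const_nhds.div_atTop (hB'.const_mul_atTop (by positivity))
  simpa using tendsto_const_nhds (x := (1 : ℝ)).sub
    (tendsto_finsetSum (Finset.univ : Finset (Fin m × Finset (Fin n))) fun x _ => this)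

end Placement

/-! ### Conditioning on the caches and restricting i.i.d. vectors. -/

/-- On a finite product space, conditioning on the first coordinate integrates out the second. -/
theorem condExp_comap_fst_ae_eq {α β : Type*} [Finite α] [Finite β] [mα : MeasurableSpace α]
    [MeasurableSpace β] [DiscreteMeasurableSpace α] [DiscreteMeasurableSpace β] (μ : Measure α)
    (ν : Measure β) [IsProbabilityMeasure μ] [IsProbabilityMeasure ν] (h : α × β → ℝ) :
    (μ.prod ν)[h | MeasurableSpace.comap Prod.fst mα] =ᵐ[μ.prod ν]
      fun ω => ∫ d, h (ω.1, d) ∂ν := by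
  have hm : MeasurableSpace.comap Prod.fst mα ≤ (inferInstance : MeasurableSpace (α × β)) :=
    measurable_fst.comap_le
  refine (ae_eq_condExp_of_forall_setIntegral_eq hm .of_finite
    (fun _ _ _ => Integrable.of_finite) ?_ ?_).symm
  · rintro _ ⟨t, _, rfl⟩ _
    have : (Prod.fst ⁻¹' t : Set (α × β)) = t ×ˢ Set.univ := by ext; simp
    rw [this, setIntegral_prod _ Integrable.of_finite.integrableOn,
      setIntegral_prod _ Integrable.of_finite.integrableOn]
    simp
  · refine StronglyMeasurable.aestronglyMeasurable ?_
    exact (StronglyMeasurable.of_discrete (f := fun a => ∫ d, h (a, d) ∂ν)).comp_measurable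
      (comap_measurable Prod.fst)

/-- Subsampling coordinates along an injection preserves product measures of i.i.d. variables. -/
theorem measurePreserving_comp_of_injective {ι κ α : Type*} [Fintype ι] [Fintype κ]
    [MeasurableSpace α] (μ : Measure α) [IsProbabilityMeasure μ] {e : ι → κ}
    (he : Function.Injective e) :
    MeasurePreserving (fun d : κ → α => d ∘ e) (Measure.pi fun _ => μ) (Measure.pi fun _ => μ) := by
  classical
  have hmeas : Measurable fun d : κ → α => d ∘ e := by
    rw [measurable_pi_iff]; exact fun i => measurable_pi_apply _
  refine ⟨hmeas, (Measure.pi_eq fun s hs => ?_).symm⟩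
  rw [Measure.map_apply hmeas (MeasurableSet.univ_pi hs)]
  -- Writing the constraint at `k` as an intersection over the preimages of `k` covers all
  -- coordinates: it is a single `s i` on the range of `e` and everything off it.
  have hpre : (fun d : κ → α => d ∘ e) ⁻¹' Set.univ.pi s =
      Set.univ.pi fun k => ⋂ i : {i // e i = k}, s i.1 := by
    ext d
    simp only [Set.mem_preimage, Set.mem_univ_pi, Function.comp, Set.mem_iInter, Subtype.forall]
    exact ⟨fun h k i hi => hi ▸ h i, fun h i => h _ i rfl⟩
  rw [hpre, Measure.pi_pi]
  rw [← Finset.prod_subset (Finset.subset_univ (Finset.univ.image e)), Finset.prod_image he.injOn]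
  · refine Finset.prod_congr rfl fun i _ => congrArg μ ?_
    ext x
    simp only [Set.mem_iInter, Subtype.forall]
    exact ⟨fun h => h i rfl, fun h j hj => he hj ▸ h⟩
  · intro k _ hk
    have : IsEmpty {i // e i = k} := ⟨fun i => hk (Finset.mem_image.2 ⟨i.1, Finset.mem_univ _, i.2⟩)⟩
    rw [Set.iInter_of_empty, measure_univ]

/-! ### Averages over the demands. -/

section Requests

variable {n m : ℕ} {q : Fin m → ℝ}

theorem isProbabilityMeasure_requestLaw (hq : ∀ f, 0 ≤ q f) (hq1 : ∑ f, q f = 1) :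
    IsProbabilityMeasure (requestLaw q) := by
  constructor
  simp [requestLaw, ← ENNReal.ofReal_sum_of_nonneg fun f _ => hq f, hq1]

theorem requestLaw_real_singleton (hq : ∀ f, 0 ≤ q f) (f : Fin m) :
    (requestLaw q).real {f} = q f := by
  rw [measureReal_def, requestLaw, Measure.finsetSum_apply]
  simp [Set.indicator_apply, ENNReal.toReal_ofReal (hq f)]

theorem isProbabilityMeasure_requestsLaw (hq : ∀ f, 0 ≤ q f) (hq1 : ∑ f, q f = 1) (ℓ : ℕ) :
    IsProbabilityMeasure (requestsLaw q ℓ) := by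
  have := isProbabilityMeasure_requestLaw hq hq1
  unfold requestsLaw
  infer_instance

/-- The expected number of distinct requested files is `mBar`. -/
theorem integral_card_image (hq : ∀ f, 0 ≤ q f) (hq1 : ∑ f, q f = 1) :
    ∫ d, ((Finset.univ.image d).card : ℝ) ∂(requestsLaw q n) = mBar n q := by
  have := isProbabilityMeasure_requestLaw hq hq1
  have := isProbabilityMeasure_requestsLaw hq hq1 n
  have hcard : ∀ d : Fin n → Fin m, ((Finset.univ.image d).card : ℝ) =
      ∑ f, Set.indicator {d : Fin n → Fin m | ∀ u, d u ≠ f}ᶜ 1 d := by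
    intro d
    rw [Finset.card_eq_sum_ones, Nat.cast_sum,
      ← Finset.sum_subset (Finset.subset_univ (Finset.univ.image d))]
    · refine Finset.sum_congr rfl fun f hf => ?_
      rw [Set.indicator_of_mem (by simpa using hf)]
      simp
    · intro f _ hf
      exact Set.indicator_of_notMem (by simpa using hf) _
  simp_rw [hcard]
  rw [integral_finsetSum _ fun _ _ => .of_finite, mBar]
  refine Finset.sum_congr rfl fun f _ => ?_
  rw [integral_indicator_one .of_discrete, probReal_compl_eq_one_sub .of_discrete]
  have hset : {d : Fin n → Fin m | ∀ u, d u ≠ f} = Set.univ.pi fun _ => ({f}ᶜ : Set (Fin m)) := by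
    ext d; simp
  rw [hset, measureReal_def, requestsLaw, Measure.pi_pi, ENNReal.toReal_prod]
  simp only [← measureReal_def]
  rw [probReal_compl_eq_one_sub .of_discrete, requestLaw_real_singleton hq]
  simp

variable {p : Fin m → ℝ} {M : ℝ} {sel : (ℓ : ℕ) → (Fin ℓ → Fin m) → Fin m}

/-- The expected maximum of `g` over the requests of a set of users. -/
theorem integral_g_sel (hq : ∀ f, 0 ≤ q f) (hq1 : ∑ f, q f = 1) {ℓ : ℕ} {e : Fin ℓ → Fin n}
    (he : Function.Injective e) :
    ∫ d, g n p M ℓ (sel ℓ (d ∘ e)) ∂(requestsLaw q n) =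
      ∑ f, rho q sel f ℓ * (p f * M) ^ (ℓ - 1) * (1 - p f * M) ^ (n - ℓ + 1) := by
  have := isProbabilityMeasure_requestLaw hq hq1
  have := isProbabilityMeasure_requestsLaw hq hq1 ℓ
  have hmp := measurePreserving_comp_of_injective (requestLaw q) he
  have h1 : ∫ d, g n p M ℓ (sel ℓ (d ∘ e)) ∂(requestsLaw q n) =
      ∫ D, g n p M ℓ (sel ℓ D) ∂(requestsLaw q ℓ) := by
    unfold requestsLaw
    rw [← hmp.map_eq, integral_map hmp.measurable.aemeasurable
      StronglyMeasurable.of_discrete.aestronglyMeasurable]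
  have h2 : ∀ D, g n p M ℓ (sel ℓ D) =
      ∑ f, Set.indicator {D | sel ℓ D = f} 1 D * g n p M ℓ f := by
    intro D
    simp [Set.indicator_apply]
  rw [h1]
  simp_rw [h2]
  rw [integral_finsetSum _ fun _ _ => .of_finite]
  refine Finset.sum_congr rfl fun f _ => ?_
  rw [integral_mul_const, integral_indicator_one .of_discrete, rho, g, mul_assoc]

/-- The largest value of `g` at the files requested by the users in `T`, zero if `T` is empty. -/
noncomputable def maxG (p : Fin m → ℝ) (M : ℝ) (sel : (ℓ : ℕ) → (Fin ℓ → Fin m) → Fin m)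
    (d : Demand n m) (T : Finset (Fin n)) : ℝ :=
  -- ψ has no term ℓ = 0; there `sel` is unconstrained and, by truncated subtraction, `g` would not
  -- vanish in general.
  if T.card = 0 then 0 else g n p M T.card (sel T.card (d ∘ T.orderEmbOfFin rfl))

theorem g_le_maxG (hsel : IsArgmaxRule n p M sel) (d : Demand n m) {T : Finset (Fin n)}
    {u : Fin n} (hu : u ∈ T) : g n p M T.card (d u) ≤ maxG p M sel d T := by
  have hpos : 0 < T.card := Finset.card_pos.2 ⟨u, hu⟩
  rw [maxG, if_neg hpos.ne']
  have hu' : u ∈ Set.range (T.orderEmbOfFin rfl) := by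
    rw [Finset.range_orderEmbOfFin]; exact hu
  obtain ⟨i, rfl⟩ := hu'
  exact (hsel T.card hpos (by simpa using T.card_le_univ) (d ∘ T.orderEmbOfFin rfl)).2 i

/-- The requests of any ℓ users are ℓ i.i.d. draws, so the mean of `maxG` depends only on the size
of T; grouping by size produces the binomial coefficients. -/
theorem integral_sum_maxG (hq : ∀ f, 0 ≤ q f) (hq1 : ∑ f, q f = 1) :
    ∫ d, ∑ T : Finset (Fin n), maxG p M sel d T ∂(requestsLaw q n) = psi n q p M sel := by
  have := isProbabilityMeasure_requestsLaw hq hq1 n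
  let Φ : ℕ → ℝ := fun ℓ => if ℓ = 0 then 0 else
    ∑ f : Fin m, rho q sel f ℓ * (p f * M) ^ (ℓ - 1) * (1 - p f * M) ^ (n - ℓ + 1)
  have hT : ∀ T : Finset (Fin n), ∫ d, maxG p M sel d T ∂(requestsLaw q n) = Φ T.card := by
    intro T
    simp only [maxG, Φ]
    split_ifs with h
    · simp
    · exact integral_g_sel hq hq1 (T.orderEmbOfFin rfl).injective
  rw [integral_finsetSum _ fun _ _ => .of_finite]
  simp_rw [hT]
  rw [← Finset.powerset_univ, Finset.sum_powerset_apply_card, Finset.card_univ, Fintype.card_fin,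
    psi]
  symm
  refine Finset.sum_subset_zero_on_sdiff (fun ℓ hℓ => ?_) (fun ℓ hℓ => ?_) fun ℓ hℓ => ?_
  · rw [Finset.mem_Icc] at hℓ
    exact Finset.mem_range.2 (by omega)
  · rw [Finset.mem_sdiff, Finset.mem_range, Finset.mem_Icc] at hℓ
    obtain rfl : ℓ = 0 := by omega
    simp [Φ]
  · rw [Finset.mem_Icc] at hℓ
    simp only [Φ, if_neg (show ℓ ≠ 0 by omega), nsmul_eq_mul]

end Requests

/-! ### Rate bounds on typical caches. -/

variable {n m B : ℕ} {q p : Fin m → ℝ} {M : ℝ} {sel : (ℓ : ℕ) → (Fin ℓ → Fin m) → Fin m}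

theorem sum_sup_exactCount_le (hsel : IsArgmaxRule n p M sel) {δ : ℝ}
    {C : CacheConfig n m B} (hC : C ∈ typicalConfigs n p M B δ) (hδ : 0 ≤ δ) (d : Demand n m) :
    ((∑ T : Finset (Fin n), T.sup fun u => exactCount C (d u) (T.erase u) : ℕ) : ℝ) ≤
      B * (∑ T : Finset (Fin n), maxG p M sel d T + 2 ^ n * δ) := by
  have hT : ∀ T : Finset (Fin n), ((T.sup fun u => exactCount C (d u) (T.erase u) : ℕ) : ℝ) ≤
      B * (maxG p M sel d T + δ) := by
    intro T
    rcases T.eq_empty_or_nonempty with rfl | hne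
    · simp only [Finset.sup_empty, maxG, Finset.card_empty, if_pos]
      simpa using mul_nonneg B.cast_nonneg hδ
    · obtain ⟨u, hu, hsup⟩ := Finset.exists_mem_eq_sup T hne
        fun u => exactCount C (d u) (T.erase u)
      rw [hsup]
      refine (hC (d u) (T.erase u)).trans ?_
      have hle := g_le_maxG hsel d hu
      have hpos : 0 < T.card := Finset.card_pos.2 hne
      have hn : T.card ≤ n := by simpa using T.card_le_univ
      -- T \ {u} has ℓ - 1 elements, so the typical proportion of its packets is g_ℓ(d u); the
      -- truncated exponents agree because 1 ≤ ℓ ≤ n.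
      rw [g, show n - T.card + 1 = n - (T.card - 1) by omega] at hle
      rw [Finset.card_erase_of_mem hu]
      gcongr
  rw [Nat.cast_sum]
  refine (Finset.sum_le_sum fun T _ => hT T).trans_eq ?_
  rw [← Finset.mul_sum, Finset.sum_add_distrib]
  simp

/-- The conditional rate of a scheme that never needs more colors than GCC can be as small as
claimed with high probability. -/
theorem tendsto_condRate_le (hM : 0 ≤ M) (hq : ∀ f, 0 ≤ q f) (hq1 : ∑ f, q f = 1)
    (hp : ∀ f, 0 ≤ p f) (hpM : ∀ f, p f * M ≤ 1) (hsel : IsArgmaxRule n p M sel)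
    {B : ℕ → ℕ} (hB : Tendsto B atTop atTop)
    (N : (F : ℕ) → CacheConfig n m (B F) → Demand n m → ℕ)
    (hN : ∀ F C d, ∃ L : List (Finset (Vertex C d)), IsGCCOutput C d L ∧ N F C d ≤ L.length)
    {ε : ℝ} (hε : 0 < ε) :
    Tendsto (fun F : ℕ => (jointLaw n q p M (B F)).real
        {ω | condRate n q p M (B F) (N F) ω ≤ min (psi n q p M sel) (mBar n q) + ε})
      atTop (𝓝 1) := by
  have := isProbabilityMeasure_requestsLaw hq hq1 n
  have hprob := fun F => isProbabilityMeasure_placementLaw (n := n) (p := p) (M := M) (B := B F) hpM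
  have hjoint : ∀ F, IsProbabilityMeasure (jointLaw n q p M (B F)) := fun F => by
    unfold jointLaw; infer_instance
  -- Each of the 2^n user sets contributes one error δ, for a total of ε.
  have hδ : 0 < ε / 2 ^ n := by positivity
  refine tendsto_of_tendsto_of_tendsto_of_le_of_le'
    (tendsto_placementLaw_typicalConfigs (n := n) hM hp hpM hB hδ) tendsto_const_nhds ?_
    (.of_forall fun F => measureReal_le_one)
  filter_upwards [hB.eventually_gt_atTop 0] with F hBF
  have hB0 : (0 : ℝ) < B F := by exact_mod_cast hBF
  have hprod : (placementLaw n p M (B F)).real (typicalConfigs n p M (B F) (ε / 2 ^ n)) =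
      (jointLaw n q p M (B F)).real
        (typicalConfigs n p M (B F) (ε / 2 ^ n) ×ˢ Set.univ) := by
    rw [jointLaw, measureReal_prod_prod, probReal_univ, mul_one]
  rw [hprod]
  -- The inclusion of typical caches in the good event is only almost sure, since the conditional
  -- expectation is determined up to null sets.
  refine ENNReal.toReal_mono (measure_ne_top _ _) (measure_mono_ae ?_)
  filter_upwards [condExp_comap_fst_ae_eq (placementLaw n p M (B F)) (requestsLaw q n)
    fun ω => (N F ω.1 ω.2 : ℝ)] with ω hω hmem
  have hC : ω.1 ∈ typicalConfigs n p M (B F) (ε / 2 ^ n) := hmem.1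
  change condRate n q p M (B F) (N F) ω ≤ _
  rw [condRate, jointLaw, hω, div_le_iff₀ hB0, min_add, min_mul_of_nonneg _ _ hB0.le, le_min_iff]
  constructor
  · calc ∫ d, (N F ω.1 d : ℝ) ∂(requestsLaw q n)
        ≤ ∫ d, B F * (∑ T : Finset (Fin n), maxG p M sel d T + 2 ^ n * (ε / 2 ^ n))
            ∂(requestsLaw q n) := by
          refine integral_mono .of_finite .of_finite fun d => ?_
          obtain ⟨L, hL, hle⟩ := hN F ω.1 d
          refine le_trans ?_ (sum_sup_exactCount_le hsel hC hδ.le d)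
          exact Nat.cast_le.2 (hle.trans hL.length_le_sum)
      _ = (psi n q p M sel + ε) * B F := by
          rw [integral_const_mul, integral_add .of_finite .of_finite, integral_sum_maxG hq hq1]
          simp [mul_comm, mul_div_cancel₀]
  · calc ∫ d, (N F ω.1 d : ℝ) ∂(requestsLaw q n)
        ≤ ∫ d, ((Finset.univ.image d).card : ℝ) * B F ∂(requestsLaw q n) := by
          refine integral_mono .of_finite .of_finite fun d => ?_
          obtain ⟨L, hL, hle⟩ := hN F ω.1 d
          dsimp only
          exact_mod_cast hle.trans hL.length_le_card_image
      _ ≤ (mBar n q + ε) * B F := by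
          rw [integral_mul_const, integral_card_image hq hq1]
          gcongr
          linarith

end Caching

theorem theorem1 (n m : ℕ) (M : ℝ) (hM : 0 ≤ M)
    (q : Fin m → ℝ) (hq : ∀ f, 0 ≤ q f) (hq1 : ∑ f, q f = 1)
    (p : Fin m → ℝ) (hp : ∀ f, 0 ≤ p f) (hp1 : ∑ f, p f = 1) (hpM : ∀ f, p f * M ≤ 1)
    (sel : (ℓ : ℕ) → (Fin ℓ → Fin m) → Fin m) (hsel : Caching.IsArgmaxRule n p M sel)
    (B : ℕ → ℕ) (hB : Tendsto B atTop atTop)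
    (out : (F : ℕ) → (C : Caching.CacheConfig n m (B F)) → (d : Caching.Demand n m) →
      List (Finset (Caching.Vertex C d)))
    (hout : ∀ F C d, Caching.IsGCCOutput C d (out F C d))
    (ε : ℝ) (hε : 0 < ε) :
    Tendsto (fun F : ℕ => (Caching.jointLaw n q p M (B F)).real
        {ω | Caching.condRate n q p M (B F) (fun C d => (out F C d).length) ω
          ≤ min (Caching.psi n q p M sel) (Caching.mBar n q) + ε}) atTop (𝓝 1) ∧
    Tendsto (fun F : ℕ => (Caching.jointLaw n q p M (B F)).real
        {ω | Caching.condRate n q p M (B F) (fun C d => Caching.cicColors C d) ω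
          ≤ min (Caching.psi n q p M sel) (Caching.mBar n q) + ε}) atTop (𝓝 1) := by
  refine ⟨Caching.tendsto_condRate_le hM hq hq1 hp hpM hsel hB _
    (fun F C d => ⟨out F C d, hout F C d, le_rfl⟩) hε, ?_⟩
  exact Caching.tendsto_condRate_le hM hq hq1 hp hpM hsel hB (fun _ C d => Caching.cicColors C d)
    (fun F C d => ⟨out F C d, hout F C d, Caching.cicColors_le (hout F C d)⟩) hε
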